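/- Let $d\ge 1$, $q\in[1,\infty]$, $R>0$, and let $\Theta=\{x\in\mathbb R^d:\|x-c\|_q\le R/2\}$ be an $\ell_q$ ball of $\ell_q$-diameter $R$. Let $\varepsilon\ge0$, $\delta\ge 0$, $\varepsilon'>0$, $\omega\in(0,1]$. Let $\simeq$ be a symmetric neighboring relation on data sets (for instance, differing in at most one entry), and let $\mathcal M$ be a randomized mechanism with outputs in $\Theta$ that is $(\varepsilon,\delta)$-differentially private: $\mathbb P[\mathcal M(D)\in S]\le e^{\varepsilon}\,\mathbb P[\mathcal M(D')\in S]+\delta$ for all $D\simeq D'$ and all measurable $S$. Put $$\Delta=2\,d^{\,1-1/q}\,R\Big(\frac{\delta}{2\omega}\Big)^{1/d}\qquad(1/\infty:=0).$$ Given an output $x_{\mathrm{apx}}$ of $\mathcal M(D)$, set $x=x_{\mathrm{apx}}$ with probability $1-\omega$ and otherwise draw $x\sim\mathrm{Unif}(\Theta)$; then output $x_{\mathrm{pure}}=x+z$, where $z_1,\dots,z_d$ are i.i.d. Laplace of scale $2\Delta/\varepsilon'$ (with $z=0$ if $\Delta=0$), all random choices being independent of each other and of $x_{\mathrm{apx}}$.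 Then: 1. (Privacy) The mechanism $D\mapsto x_{\mathrm{pure}}$ is $(\varepsilon+\varepsilon')$-pure differentially private, that is, $(\varepsilon+\varepsilon',0)$-differentially private. 2. (Utility) For every data set $D$, if $q=1$, then $$\mathbb E\|x_{\mathrm{pure}}-x_{\mathrm{apx}}\|_1\le \omega R+\frac{4Rd}{\varepsilon'}\Big(\frac{\delta}{2\omega}\Big)^{1/d}.$$ More generally, for every $q<\infty$, $$\mathbb E\|x_{\mathrm{pure}}-x_{\mathrm{apx}}\|_q\le \omega R+\frac{4Rdq}{\varepsilon'}\Big(\frac{\delta}{2\omega}\Big)^{1/d},$$ and for every $q\in[1,\infty]$, $$\mathbb E\|x_{\mathrm{pure}}-x_{\mathrm{apx}}\|_1\le d^{\,1-1/q}\Big(\omega R+\frac{4Rd}{\varepsilon'}\Big(\frac{\delta}{2\omega}\Big)^{1/d}\Big).$$ -/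

import Mathlib

open MeasureTheory ProbabilityTheory
open scoped ENNReal

noncomputable section

namespace Purify

/-- The `ℓ_q` norm of `v ∈ ℝ^d`, `q ∈ [1, ∞]`:
`(∑ i, |v i| ^ q) ^ (1 / q)` for finite `q`, and `max_i |v i|` for `q = ∞`. -/
def lqNorm {d : ℕ} (q : ℝ≥0∞) (v : Fin d → ℝ) : ℝ :=
  ‖(WithLp.toLp q v : PiLp q fun _ : Fin d => ℝ)‖

/-- The closed `ℓ_q` ball of centre `c` and radius `ρ`; its `ℓ_q` diameter is `2 * ρ`. -/
def lqBall {d : ℕ} (q : ℝ≥0∞) (c : Fin d → ℝ) (ρ : ℝ) : Set (Fin d → ℝ) :=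
  {x | lqNorm q (x - c) ≤ ρ}

/-- The uniform distribution on a set, with respect to Lebesgue measure. -/
def unif {E : Type*} [MeasureSpace E] (S : Set E) : Measure E :=
  ProbabilityTheory.cond volume S

/-- The centred Laplace distribution of scale `b`, of density `exp (-|x| / b) / (2 * b)`.
At scale `0` it is the point mass at `0` (no noise). -/
def laplace (b : ℝ) : Measure ℝ :=
  if b = 0 then Measure.dirac 0
  else volume.withDensity fun x => ENNReal.ofReal (Real.exp (-|x| / b) / (2 * b))

/-- The law of `d` i.i.d. Laplace variables of scale `b`. -/
def laplaceVec (d : ℕ) (b : ℝ) : Measure (Fin d → ℝ) :=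
  Measure.pi fun _ => laplace b

/-- `(ε, δ)`-differential privacy of a mechanism, given by the output law `M D` on every data set
`D`, with respect to a relation `nbr` of being neighbours. Pure `ε`-DP is the case `δ = 0`. -/
def IsDP {𝒟 Y : Type*} [MeasurableSpace Y] (nbr : 𝒟 → 𝒟 → Prop) (M : 𝒟 → Measure Y)
    (ε δ : ℝ) : Prop :=
  ∀ D D', nbr D D' → ∀ S, MeasurableSet S →
    (M D).real S ≤ Real.exp ε * (M D').real S + δ

/-- The parameter `Δ = 2 d^{1 - 1/q} R (δ / (2ω))^{1/d}`. -/
def noiseDelta (d : ℕ) (q : ℝ≥0∞) (R δ ω : ℝ) : ℝ :=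
  2 * (d : ℝ) ^ (1 - (q⁻¹).toReal) * R * (δ / (2 * ω)) ^ (1 / (d : ℝ))

/-- The purified point, as a function of the input `x` and of the random draws: `t` decides whether
`x` is kept (`ω < t`) or replaced by `y`, and then the noise `z` is added. -/
def purifyPoint {d : ℕ} (ω : ℝ) (x : Fin d → ℝ) (t : ℝ) (y z : Fin d → ℝ) : Fin d → ℝ :=
  (if t ≤ ω then y else x) + z

/-- The joint law of the pair `(x_apx, x_pure)`, when `x_apx` has law `μ`: independently of
`x_apx`, draw `t ∼ Unif [0, 1]`, `y ∼ Unif Θ` and Laplace noise `z` of scale `2 Δ / ε'`. -/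
def purifyJoint {d : ℕ} (q : ℝ≥0∞) (R ε' δ ω : ℝ) (Θ : Set (Fin d → ℝ))
    (μ : Measure (Fin d → ℝ)) : Measure ((Fin d → ℝ) × (Fin d → ℝ)) :=
  (μ.prod ((unif (Set.Icc (0 : ℝ) 1)).prod
      ((unif Θ).prod (laplaceVec d (2 * noiseDelta d q R δ ω / ε'))))).map
    fun s => (s.1, purifyPoint ω s.1 s.2.1 s.2.2.1 s.2.2.2)

/-- The law of the output `x_pure`, when `x_apx` has law `μ`. -/
def purify {d : ℕ} (q : ℝ≥0∞) (R ε' δ ω : ℝ) (Θ : Set (Fin d → ℝ))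
    (μ : Measure (Fin d → ℝ)) : Measure (Fin d → ℝ) :=
  (purifyJoint q R ε' δ ω Θ μ).map Prod.snd

end Purify

end

/-!
Fix a measurable set `S`. Since the Laplace noise has a log-Lipschitz density, the probability
`h x` that the noisy version of `x` lands in `S` is a log-Lipschitz function of `x`. For every
level `t`, unless one of the inequalities `h ≤ t` and `t ≤ exp ε' * h` holds throughout `Θ`, the
region between the superlevel sets `{t < h}` and `{t ≤ exp ε' * h}` contains a homothetic copy of
`Θ` of ratio `r = (δ / ω) ^ (1 / d)`. Under the uniform component of weight `ω` this copy has mass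
`ω * r ^ d = δ`, which absorbs the additive error of the approximate guarantee. Integrating over
`t` gives the pure guarantee.

For the utility bounds, replacement moves the point by at most `R` and happens with probability
`ω`; Jensen's inequality bounds the mean norm of the noise by its `q`-th moment, and
`Γ (q + 1) ≤ q ^ q`.
-/

namespace Purify

section LqNorm

variable {d : ℕ} (q : ℝ≥0∞)

/-- The function `lqNorm q` as a seminorm on `Fin d → ℝ`, whose own norm and topology are those of
the sup norm. -/
noncomputable def lqSeminorm (d : ℕ) [Fact (1 ≤ q)] : Seminorm ℝ (Fin d → ℝ) :=
  (normSeminorm ℝ (PiLp q fun _ : Fin d => ℝ)).comp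
    (WithLp.linearEquiv q ℝ (Fin d → ℝ)).symm.toLinearMap

theorem lqSeminorm_apply [Fact (1 ≤ q)] (v : Fin d → ℝ) : lqSeminorm q d v = lqNorm q v :=
  rfl

theorem continuous_lqSeminorm [Fact (1 ≤ q)] : Continuous (lqSeminorm q d) :=
  (continuous_norm (E := PiLp q fun _ : Fin d => ℝ)).comp (PiLp.continuous_toLp q _)

theorem norm_le_lqNorm [Fact (1 ≤ q)] (v : Fin d → ℝ) : ‖v‖ ≤ lqNorm q v :=
  (pi_norm_le_iff_of_nonneg (norm_nonneg _)).2
    (PiLp.norm_apply_le (WithLp.toLp q v : PiLp q fun _ : Fin d => ℝ))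

theorem lqNorm_one (v : Fin d → ℝ) : lqNorm 1 v = ∑ i, |v i| := by
  simp [lqNorm, PiLp.norm_eq_sum (p := 1) (by simp)]

variable {q}

theorem lqNorm_eq_sum (hq0 : q ≠ 0) (hq : q ≠ ∞) (v : Fin d → ℝ) :
    lqNorm q v = (∑ i, |v i| ^ q.toReal) ^ (1 / q.toReal) := by
  simp [lqNorm, PiLp.norm_eq_sum (ENNReal.toReal_pos hq0 hq)]

theorem lqNorm_rpow_eq_sum (hq0 : q ≠ 0) (hq : q ≠ ∞) (v : Fin d → ℝ) :
    lqNorm q v ^ q.toReal = ∑ i, |v i| ^ q.toReal := by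
  rw [lqNorm_eq_sum hq0 hq, one_div,
    Real.rpow_inv_rpow (by positivity) (ENNReal.toReal_pos hq0 hq).ne']

theorem one_le_toReal (hq1 : 1 ≤ q) (hq : q ≠ ∞) : 1 ≤ q.toReal :=
  ENNReal.toReal_mono hq hq1

theorem lqNorm_one_le (hq1 : 1 ≤ q) (v : Fin d → ℝ) :
    lqNorm 1 v ≤ (d : ℝ) ^ (1 - (q⁻¹).toReal) * lqNorm q v := by
  have : Fact (1 ≤ q) := ⟨hq1⟩
  rw [lqNorm_one]
  rcases eq_or_ne q ∞ with rfl | hq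
  · have hle : ∀ i, |v i| ≤ lqNorm ∞ v := fun i =>
      PiLp.norm_apply_le (WithLp.toLp ∞ v : PiLp ∞ fun _ : Fin d => ℝ) i
    simpa using Finset.sum_le_sum fun i (_ : i ∈ Finset.univ) => hle i
  · have hs := one_le_toReal hq1 hq
    have hq0 : q ≠ 0 := (zero_lt_one.trans_le hq1).ne'
    have hnn : 0 ≤ lqNorm q v := norm_nonneg _
    -- raised to the power `q`, this is the power mean inequality
    refine (Real.rpow_le_rpow_iff (by positivity) (by positivity) (zero_lt_one.trans_le hs)).1 ?_
    have hexp : (1 - (q⁻¹).toReal) * q.toReal = q.toReal - 1 := by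
      rw [ENNReal.toReal_inv]
      field_simp
    rw [Real.mul_rpow (by positivity) hnn, lqNorm_rpow_eq_sum hq0 hq,
      ← Real.rpow_mul (Nat.cast_nonneg d), hexp]
    simpa using Real.rpow_sum_le_const_mul_sum_rpow Finset.univ v hs

end LqNorm

section LqBall

variable {d : ℕ} {q : ℝ≥0∞} [Fact (1 ≤ q)] {c : Fin d → ℝ} {ρ : ℝ}

theorem lqBall_eq_closedBall : lqBall q c ρ = (lqSeminorm q d).closedBall c ρ :=
  rfl

theorem convex_lqBall : Convex ℝ (lqBall q c ρ) :=
  (lqSeminorm q d).convex_closedBall c ρ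

theorem lqNorm_sub_le_of_mem_lqBall {x y : Fin d → ℝ}
    (hx : x ∈ lqBall q c ρ) (hy : y ∈ lqBall q c ρ) : lqNorm q (x - y) ≤ 2 * ρ := by
  rw [lqBall_eq_closedBall, Seminorm.mem_closedBall] at hx hy
  calc lqNorm q (x - y) = lqSeminorm q d ((x - c) - (y - c)) := by
        rw [sub_sub_sub_cancel_right, lqSeminorm_apply]
    _ ≤ lqSeminorm q d (x - c) + lqSeminorm q d (y - c) := map_sub_le_add _ _ _
    _ ≤ 2 * ρ := by linarith

theorem volume_lqBall_ne_zero (hρ : 0 < ρ) : volume (lqBall q c ρ) ≠ 0 := by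
  have hopen : IsOpen {x | lqSeminorm q d (x - c) < ρ} :=
    isOpen_lt ((continuous_lqSeminorm q).comp (continuous_sub_right c)) continuous_const
  have hpos : 0 < volume {x | lqSeminorm q d (x - c) < ρ} :=
    hopen.measure_pos volume ⟨c, by simpa using hρ⟩
  exact (hpos.trans_le (measure_mono fun x (hx : _ < ρ) => hx.le)).ne'

theorem volume_ne_top_of_lqNorm_sub_le {Θ : Set (Fin d → ℝ)} {R : ℝ}
    (hΘ : ∀ x ∈ Θ, ∀ y ∈ Θ, lqNorm q (x - y) ≤ R) : volume Θ ≠ ∞ := by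
  refine (Metric.isBounded_iff.2 ⟨R, fun x hx y hy => ?_⟩).measure_lt_top.ne
  exact (dist_eq_norm x y).trans_le ((norm_le_lqNorm q _).trans (hΘ x hx y hy))

end LqBall

section Laplace

theorem integrable_comp_abs {f : ℝ → ℝ} (hf : IntegrableOn f (Set.Ioi 0)) :
    Integrable fun x => f |x| := by
  have hpos : IntegrableOn (fun x => f |x|) (Set.Ioi 0) :=
    hf.congr_fun (fun x hx => by rw [abs_of_pos (Set.mem_Ioi.1 hx)]) measurableSet_Ioi
  have hneg := hpos.comp_neg
  simp only [abs_neg, Set.neg_Ioi, neg_zero] at hneg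
  rw [← integrableOn_univ, ← Set.Iic_union_Ioi (a := (0 : ℝ))]
  exact ((integrableOn_Iic_iff_integrableOn_Iio (by finiteness)).2 hneg).union hpos

variable {b s : ℝ}

theorem rpow_mul_laplaceDensity_eq (b s x : ℝ) :
    x ^ s * (Real.exp (-x / b) / (2 * b)) =
      (2 * b)⁻¹ * (x ^ s * Real.exp (-(b⁻¹ * x))) := by
  rw [neg_div, div_eq_inv_mul x]
  ring

theorem integrable_abs_rpow_mul_laplaceDensity (hb : 0 < b) (hs : -1 < s) :
    Integrable fun x : ℝ => |x| ^ s * (Real.exp (-|x| / b) / (2 * b)) := by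
  refine integrable_comp_abs (f := fun x => x ^ s * (Real.exp (-x / b) / (2 * b))) ?_
  simp_rw [rpow_mul_laplaceDensity_eq]
  have h := integrableOn_rpow_mul_exp_neg_mul_rpow (p := 1) hs one_pos (inv_pos.2 hb)
  simp_rw [Real.rpow_one, neg_mul] at h
  exact h.const_mul _

theorem integral_abs_rpow_mul_laplaceDensity (hb : 0 < b) (hs : -1 < s) :
    ∫ x : ℝ, |x| ^ s * (Real.exp (-|x| / b) / (2 * b)) = b ^ s * Real.Gamma (s + 1) := by
  have h := Real.integral_rpow_mul_exp_neg_mul_Ioi (by linarith : 0 < s + 1) (inv_pos.2 hb)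
  rw [add_sub_cancel_right, one_div, inv_inv, Real.rpow_add hb, Real.rpow_one] at h
  rw [integral_comp_abs (f := fun x => x ^ s * (Real.exp (-x / b) / (2 * b)))]
  simp_rw [rpow_mul_laplaceDensity_eq]
  rw [integral_const_mul, h]
  field_simp

theorem measurable_laplaceDensity (b : ℝ) :
    Measurable fun x : ℝ => ENNReal.ofReal (Real.exp (-|x| / b) / (2 * b)) := by
  fun_prop

theorem laplace_of_pos (hb : 0 < b) :
    laplace b = volume.withDensity fun x =>
      ENNReal.ofReal (Real.exp (-|x| / b) / (2 * b)) :=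
  if_neg hb.ne'

theorem isProbabilityMeasure_laplace (hb : 0 ≤ b) : IsProbabilityMeasure (laplace b) := by
  rcases hb.eq_or_lt with rfl | hb
  · rw [laplace, if_pos rfl]
    infer_instance
  · have hi := integrable_abs_rpow_mul_laplaceDensity hb (s := 0) (by norm_num)
    have he := integral_abs_rpow_mul_laplaceDensity hb (s := 0) (by norm_num)
    simp only [Real.rpow_zero, one_mul, zero_add, Real.Gamma_one] at hi he
    refine ⟨?_⟩
    rw [laplace_of_pos hb, withDensity_apply _ MeasurableSet.univ, setLIntegral_univ,
      ← ofReal_integral_eq_lintegral_ofReal hi (ae_of_all _ fun x => by positivity), he,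
      ENNReal.ofReal_one]

theorem toReal_ofReal_laplaceDensity (hb : 0 < b) (x : ℝ) :
    (ENNReal.ofReal (Real.exp (-|x| / b) / (2 * b))).toReal =
      Real.exp (-|x| / b) / (2 * b) :=
  ENNReal.toReal_ofReal (by positivity)

theorem integrable_abs_rpow_laplace (hb : 0 ≤ b) (hs : -1 < s) :
    Integrable (fun x : ℝ => |x| ^ s) (laplace b) := by
  rcases hb.eq_or_lt with rfl | hb
  · rw [laplace, if_pos rfl]
    exact integrable_dirac (by simp)
  · rw [laplace_of_pos hb, integrable_withDensity_iff (measurable_laplaceDensity b) (by simp)]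
    simp_rw [toReal_ofReal_laplaceDensity hb]
    exact integrable_abs_rpow_mul_laplaceDensity hb hs

theorem integral_abs_rpow_laplace (hb : 0 ≤ b) (hs : -1 < s) :
    ∫ x : ℝ, |x| ^ s ∂laplace b = b ^ s * Real.Gamma (s + 1) := by
  rcases hb.eq_or_lt with rfl | hb
  · rw [laplace, if_pos rfl, integral_dirac, abs_zero]
    rcases eq_or_ne s 0 with rfl | hs0
    · simp
    · simp [Real.zero_rpow hs0]
  · rw [laplace_of_pos hb,
      integral_withDensity_eq_integral_toReal_smul (measurable_laplaceDensity b) (by simp)]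
    simp_rw [toReal_ofReal_laplaceDensity hb, smul_eq_mul, mul_comm _ (|_| ^ s)]
    exact integral_abs_rpow_mul_laplaceDensity hb hs

theorem map_const_add_withDensity {G : Type*} [AddGroup G] [MeasurableSpace G] [MeasurableAdd G]
    (μ : Measure G) [μ.IsAddLeftInvariant] {f : G → ℝ≥0∞} (hf : Measurable f) (a : G) :
    (μ.withDensity f).map (a + ·) = μ.withDensity fun x => f (-a + x) := by
  ext S hS
  have hsub := (measurePreserving_add_left μ a).setLIntegral_comp_preimage hS
    (hf.comp (measurable_const_add (-a)))
  simp only [Function.comp_apply, neg_add_cancel_left] at hsub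
  rw [Measure.map_apply (measurable_const_add a) hS,
    withDensity_apply _ (measurable_const_add a hS), withDensity_apply _ hS, hsub]

theorem map_const_add_laplace_le (hb : 0 < b) (a : ℝ) :
    (laplace b).map (a + ·) ≤ ENNReal.ofReal (Real.exp (|a| / b)) • laplace b := by
  rw [laplace_of_pos hb, map_const_add_withDensity _ (measurable_laplaceDensity b),
    ← withDensity_smul _ (measurable_laplaceDensity b)]
  refine withDensity_mono (ae_of_all _ fun x => ?_)
  rw [Pi.smul_apply, smul_eq_mul, ← ENNReal.ofReal_mul (Real.exp_pos _).le, ← mul_div_assoc,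
    ← Real.exp_add, ← add_div]
  have htri : |x| ≤ |a| + |-a + x| := by simpa using abs_add_le a (-a + x)
  have hexp : (-|-a + x|) / b ≤ (|a| + -|x|) / b := by
    gcongr
    linarith
  exact ENNReal.ofReal_le_ofReal (by gcongr)

end Laplace

section Pi

variable {ι : Type*} [Fintype ι] {α : ι → Type*} [∀ i, MeasurableSpace (α i)]

theorem pi_mono {μ ν : ∀ i, Measure (α i)} [∀ i, SigmaFinite (μ i)] (h : ∀ i, μ i ≤ ν i) :
    Measure.pi μ ≤ Measure.pi ν := by
  have hout : (Measure.pi μ).toOuterMeasure ≤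
      OuterMeasure.pi fun i => (ν i).toOuterMeasure := by
    refine OuterMeasure.le_pi.2 fun s _ => ?_
    change Measure.pi μ (Set.univ.pi s) ≤ _
    rw [Measure.pi_pi]
    exact Finset.prod_le_prod' fun i _ => h i (s i)
  refine Measure.le_iff.2 fun S _ => (hout S).trans ?_
  rw [Measure.pi_def]
  exact le_toMeasure_apply _ _ _

theorem pi_smul (k : ι → ℝ≥0∞) (hk : ∀ i, k i ≠ ∞) (μ : ∀ i, Measure (α i))
    [∀ i, SigmaFinite (μ i)] :
    Measure.pi (fun i => k i • μ i) = (∏ i, k i) • Measure.pi μ := by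
  have : ∀ i, SigmaFinite (k i • μ i) := fun i => by
    rw [← ENNReal.coe_toNNReal (hk i)]
    exact SMul.sigmaFinite (k i).toNNReal
  refine Measure.pi_eq fun s _ => ?_
  simp only [Measure.smul_apply, Measure.pi_pi, smul_eq_mul, Finset.prod_mul_distrib]

end Pi

section LaplaceVec

variable {d : ℕ} {b : ℝ}

theorem isProbabilityMeasure_laplaceVec (hb : 0 ≤ b) :
    IsProbabilityMeasure (laplaceVec d b) := by
  have := isProbabilityMeasure_laplace hb
  unfold laplaceVec
  infer_instance

theorem map_const_add_laplaceVec_le (hb : 0 < b) (a : Fin d → ℝ) :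
    (laplaceVec d b).map (a + ·) ≤
      ENNReal.ofReal (Real.exp (lqNorm 1 a / b)) • laplaceVec d b := by
  have := isProbabilityMeasure_laplace hb.le
  have : ∀ i, IsProbabilityMeasure ((laplace b).map (a i + ·)) := fun i =>
    Measure.isProbabilityMeasure_map (measurable_const_add (a i)).aemeasurable
  calc (laplaceVec d b).map (a + ·)
      = Measure.pi fun i => (laplace b).map (a i + ·) :=
        Measure.pi_map_pi (f := fun i x => a i + x)
          fun i => (measurable_const_add (a i)).aemeasurable
    _ ≤ Measure.pi fun i => ENNReal.ofReal (Real.exp (|a i| / b)) • laplace b :=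
        pi_mono fun i => map_const_add_laplace_le hb (a i)
    _ = (∏ i, ENNReal.ofReal (Real.exp (|a i| / b))) • laplaceVec d b :=
        pi_smul _ (fun i => ENNReal.ofReal_ne_top) _
    _ = ENNReal.ofReal (Real.exp (lqNorm 1 a / b)) • laplaceVec d b := by
        rw [← ENNReal.ofReal_prod_of_nonneg fun i _ => (Real.exp_pos _).le, ← Real.exp_sum,
          ← Finset.sum_div, lqNorm_one]

end LaplaceVec

section LogLipschitz

variable {E : Type*} [AddCommGroup E] [Module ℝ E]

/-- A nonnegative function whose logarithm is `K`-Lipschitz for the seminorm `p`. The condition is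
stated multiplicatively, so that `h` may vanish identically. -/
structure LogLipschitz (K : ℝ) (p : Seminorm ℝ E) (h : E → ℝ) : Prop where
  nonneg : ∀ x, 0 ≤ h x
  le_exp_mul : ∀ x y, h x ≤ Real.exp (K * p (x - y)) * h y

namespace LogLipschitz

variable {K : ℝ} {p : Seminorm ℝ E} {h : E → ℝ}

theorem le_of_sub_le (hh : LogLipschitz K p h) (hK : 0 ≤ K) {x y : E} {ρ : ℝ}
    (hxy : p (x - y) ≤ ρ) : h x ≤ Real.exp (K * ρ) * h y :=
  (hh.le_exp_mul x y).trans <| by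
    have := hh.nonneg y
    gcongr

theorem continuous [TopologicalSpace E] [IsTopologicalAddGroup E] (hh : LogLipschitz K p h)
    (hp : Continuous p) : Continuous h := by
  refine continuous_iff_continuousAt.2 fun x => ?_
  have hup : Continuous fun y => Real.exp (K * p (y - x)) * h x := by fun_prop
  have hlo : Continuous fun y => (Real.exp (K * p (x - y)))⁻¹ * h x :=
    (Continuous.inv₀ (by fun_prop) fun y => (Real.exp_pos _).ne').mul continuous_const
  refine tendsto_of_tendsto_of_tendsto_of_le_of_le
    (by simpa [ContinuousAt] using hlo.continuousAt (x := x))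
    (by simpa [ContinuousAt] using hup.continuousAt (x := x))
    (fun y => (inv_mul_le_iff₀ (Real.exp_pos _)).2 (hh.le_exp_mul x y))
    (fun y => hh.le_exp_mul y x)

theorem superlevel_subset (hh : LogLipschitz K p h) {c : ℝ} (hc : 0 ≤ c) (t : ℝ) :
    {x | t < h x} ⊆ {x | t ≤ Real.exp c * h x} := fun x (hx : t < h x) =>
  hx.le.trans (le_mul_of_one_le_left (hh.nonneg x) (Real.one_le_exp hc))

/-- The centre of the homothety is a point where `h = t / exp (K * (r * D))`. -/
theorem exists_homothety_image_subset [TopologicalSpace E] [IsTopologicalAddGroup E]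
    (hh : LogLipschitz K p h) (hK : 0 ≤ K) (hp : Continuous p) {Θ : Set E}
    (hΘ : IsPreconnected Θ) {D : ℝ} (hD : ∀ x ∈ Θ, ∀ y ∈ Θ, p (x - y) ≤ D) {r : ℝ} (hr : 0 ≤ r)
    {t : ℝ} {x y : E} (hx : x ∈ Θ) (hxt : t ≤ h x) (hy : y ∈ Θ)
    (hyt : Real.exp (2 * (K * (r * D))) * h y ≤ t) :
    ∃ w ∈ Θ, ∀ u ∈ AffineMap.homothety w r '' Θ,
      h u ≤ t ∧ t ≤ Real.exp (2 * (K * (r * D))) * h u := by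
  have hD0 : 0 ≤ D := (apply_nonneg p _).trans (hD x hx y hy)
  have hsq : Real.exp (2 * (K * (r * D))) = Real.exp (K * (r * D)) * Real.exp (K * (r * D)) := by
    rw [two_mul, Real.exp_add]
  rw [hsq] at hyt ⊢
  set κ := Real.exp (K * (r * D))
  have hκ0 : 0 < κ := Real.exp_pos _
  have hκ1 : 1 ≤ κ := Real.one_le_exp (by positivity)
  have hyκ : h y ≤ t / κ := by
    rw [le_div_iff₀ hκ0]
    nlinarith [mul_nonneg hκ0.le (hh.nonneg y)]
  have hxκ : t / κ ≤ h x := by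
    rw [div_le_iff₀ hκ0]
    nlinarith [hh.nonneg x]
  obtain ⟨w, hw, hwt⟩ : t / κ ∈ h '' Θ :=
    hΘ.intermediate_value hy hx (hh.continuous hp).continuousOn ⟨hyκ, hxκ⟩
  have hκw : κ * h w = t := by rw [hwt, mul_div_cancel₀ _ hκ0.ne']
  refine ⟨w, hw, ?_⟩
  rintro _ ⟨v, hv, rfl⟩
  have hdist : p (AffineMap.homothety w r v - w) ≤ r * D := by
    rw [AffineMap.homothety_apply, vsub_eq_sub, vadd_eq_add, add_sub_cancel_right,
      map_smul_eq_mul, Real.norm_of_nonneg hr]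
    gcongr
    exact hD v hv w hw
  constructor
  · exact (hh.le_of_sub_le hK hdist).trans_eq hκw
  · rw [map_sub_rev] at hdist
    calc t = κ * h w := hκw.symm
      _ ≤ κ * (κ * h _) := by
        gcongr
        exact hh.le_of_sub_le hK hdist
      _ = κ * κ * h _ := (mul_assoc _ _ _).symm

end LogLipschitz

end LogLipschitz

section Unif

variable {E : Type*} [MeasureSpace E] {Θ : Set E}

theorem isProbabilityMeasure_unif (h0 : volume Θ ≠ 0) (hfin : volume Θ ≠ ∞) :
    IsProbabilityMeasure (unif Θ) :=
  cond_isProbabilityMeasure_of_finite h0 hfin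

theorem unif_apply_of_subset {A : Set E} (hA : A ⊆ Θ) :
    unif Θ A = (volume Θ)⁻¹ * volume A := by
  rw [unif, ProbabilityTheory.cond, Measure.smul_apply, Measure.restrict_eq_self _ hA,
    smul_eq_mul]

variable [NormedAddCommGroup E] [NormedSpace ℝ E] [FiniteDimensional ℝ E] [BorelSpace E]
  [(volume : Measure E).IsAddHaarMeasure]

theorem ae_mem_unif (hΘ : Convex ℝ Θ) : ∀ᵐ x ∂unif Θ, x ∈ Θ :=
  ae_cond_mem₀ (hΘ.nullMeasurableSet _)

theorem unif_real_homothety_image (hΘ : Convex ℝ Θ) (h0 : volume Θ ≠ 0) (hfin : volume Θ ≠ ∞)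
    {w : E} (hw : w ∈ Θ) {r : ℝ} (hr0 : 0 ≤ r) (hr1 : r ≤ 1) :
    (unif Θ).real (AffineMap.homothety w r '' Θ) = r ^ Module.finrank ℝ E := by
  have hsub : AffineMap.homothety w r '' Θ ⊆ Θ := by
    rintro _ ⟨v, hv, rfl⟩
    rw [AffineMap.homothety_eq_lineMap]
    exact hΘ.lineMap_mem hw hv ⟨hr0, hr1⟩
  have hpow : 0 ≤ r ^ Module.finrank ℝ E := pow_nonneg hr0 _
  rw [measureReal_def, unif_apply_of_subset hsub, Measure.addHaar_image_homothety, mul_left_comm,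
    ENNReal.inv_mul_cancel h0 hfin, mul_one, abs_of_nonneg hpow, ENNReal.toReal_ofReal hpow]

variable {K : ℝ} {p : Seminorm ℝ E} {h : E → ℝ}

/-- Unless one of the two superlevel sets is trivial on `Θ`, a homothetic copy of `Θ` of ratio `r`
fits between them. -/
theorem LogLipschitz.unif_superlevel_trichotomy (hh : LogLipschitz K p h) (hK : 0 ≤ K)
    (hp : Continuous p) (hΘ : Convex ℝ Θ) (h0 : volume Θ ≠ 0) (hfin : volume Θ ≠ ∞) {D : ℝ}
    (hD : ∀ x ∈ Θ, ∀ y ∈ Θ, p (x - y) ≤ D) {r : ℝ} (hr : 0 ≤ r) (t : ℝ) :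
    (∀ x ∈ Θ, h x ≤ t) ∨ (∀ x ∈ Θ, t ≤ Real.exp (2 * (K * (r * D))) * h x) ∨
      (unif Θ).real {x | t < h x} + r ^ Module.finrank ℝ E ≤
        (unif Θ).real {x | t ≤ Real.exp (2 * (K * (r * D))) * h x} := by
  by_contra! ⟨⟨x, hx, hxt⟩, ⟨y, hy, hyt⟩, hgap⟩
  have := isProbabilityMeasure_unif h0 hfin
  have hD0 : 0 ≤ D := (apply_nonneg p _).trans (hD x hx y hy)
  have hr1 : r ≤ 1 := by
    by_contra! hr1
    have hxy : p (x - y) ≤ r * D := (hD x hx y hy).trans (le_mul_of_one_le_left hD0 hr1.le)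
    have hexp : Real.exp (K * (r * D)) * h y ≤ Real.exp (2 * (K * (r * D))) * h y := by
      have hKrD : 0 ≤ K * (r * D) := by positivity
      exact mul_le_mul_of_nonneg_right (Real.exp_le_exp.2 (by linarith)) (hh.nonneg y)
    linarith [hh.le_of_sub_le hK hxy]
  obtain ⟨w, hw, hA⟩ :=
    hh.exists_homothety_image_subset hK hp hΘ.isPreconnected hD hr hx hxt.le hy hyt.le
  have hdisj : Disjoint {x | t < h x} (AffineMap.homothety w r '' Θ) :=
    Set.disjoint_right.2 fun u hu => (hA u hu).1.not_gt
  refine hgap.not_ge ?_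
  rw [← unif_real_homothety_image hΘ h0 hfin hw hr hr1,
    ← measureReal_union' hdisj (isOpen_lt continuous_const (hh.continuous hp)).measurableSet]
  exact measureReal_mono
    (Set.union_subset (hh.superlevel_subset (by positivity) t) fun u hu => (hA u hu).2)

end Unif

section ApproxLE

variable {Y : Type*} [MeasurableSpace Y]

/-- The one-sided comparison of two laws that `IsDP` requires of the output laws on neighbouring
data sets. -/
def IsApproxLE (ε δ : ℝ) (P Q : Measure Y) : Prop :=
  ∀ S, MeasurableSet S → P.real S ≤ Real.exp ε * Q.real S + δ

/-- The mixture of `μ` and `ν` with weights `1 - ω` and `ω`: the law of a point drawn from `μ` and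
replaced by one drawn from `ν` with probability `ω`. -/
noncomputable def mixture (ω : ℝ) (μ ν : Measure Y) : Measure Y :=
  ENNReal.ofReal (1 - ω) • μ + ENNReal.ofReal ω • ν

variable {ε δ ω : ℝ} {P Q U : Measure Y}

theorem IsApproxLE.mono {ε' : ℝ} (h : IsApproxLE ε δ P Q) (hε : ε ≤ ε') :
    IsApproxLE ε' δ P Q := fun S hS =>
  (h S hS).trans (by gcongr)

theorem isApproxLE_zero_iff [IsFiniteMeasure P] [IsFiniteMeasure Q] :
    IsApproxLE ε 0 P Q ↔ P ≤ ENNReal.ofReal (Real.exp ε) • Q := by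
  rw [Measure.le_iff]
  refine forall₂_congr fun S _ => ?_
  rw [add_zero, Measure.smul_apply, smul_eq_mul, ← ofReal_measureReal (μ := P),
    ← ofReal_measureReal (μ := Q), ← ENNReal.ofReal_mul (Real.exp_pos _).le,
    ENNReal.ofReal_le_ofReal_iff (by positivity)]

theorem mixture_real [IsFiniteMeasure P] [IsFiniteMeasure U] (hω : 0 ≤ ω) (hω1 : ω ≤ 1)
    (S : Set Y) : (mixture ω P U).real S = (1 - ω) * P.real S + ω * U.real S := by
  rw [mixture, measureReal_add_apply
      (h₁ := ENNReal.mul_ne_top ENNReal.ofReal_ne_top (measure_ne_top P S))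
      (h₂ := ENNReal.mul_ne_top ENNReal.ofReal_ne_top (measure_ne_top U S)),
    measureReal_ennreal_smul_apply, measureReal_ennreal_smul_apply,
    ENNReal.toReal_ofReal (sub_nonneg.2 hω1), ENNReal.toReal_ofReal hω]

theorem isProbabilityMeasure_mixture [IsProbabilityMeasure P] [IsProbabilityMeasure U]
    (hω : 0 ≤ ω) (hω1 : ω ≤ 1) : IsProbabilityMeasure (mixture ω P U) := by
  refine ⟨?_⟩
  rw [mixture, Measure.add_apply, Measure.smul_apply, Measure.smul_apply, measure_univ,
    measure_univ, smul_eq_mul, smul_eq_mul, mul_one, mul_one,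
    ← ENNReal.ofReal_add (sub_nonneg.2 hω1) hω, sub_add_cancel, ENNReal.ofReal_one]

theorem ae_mixture {p : Y → Prop} (hP : ∀ᵐ x ∂P, p x) (hU : ∀ᵐ x ∂U, p x) :
    ∀ᵐ x ∂mixture ω P U, p x :=
  ae_add_measure_iff.2 ⟨Measure.ae_smul_measure hP _, Measure.ae_smul_measure hU _⟩

theorem IsApproxLE.mixture_real_le [IsFiniteMeasure P] [IsFiniteMeasure Q] [IsFiniteMeasure U]
    (hPQ : IsApproxLE ε δ P Q) (hε : 0 ≤ ε) (hω : 0 ≤ ω) (hω1 : ω ≤ 1) {S T : Set Y}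
    (hS : MeasurableSet S) (hST : S ⊆ T) (hgap : (1 - ω) * δ + ω * U.real S ≤ ω * U.real T) :
    (mixture ω P U).real S ≤ Real.exp ε * (mixture ω Q U).real T := by
  rw [mixture_real hω hω1, mixture_real hω hω1]
  have := sub_nonneg.2 hω1
  calc (1 - ω) * P.real S + ω * U.real S
      ≤ (1 - ω) * (Real.exp ε * Q.real T + δ) + ω * U.real S := by
        have hQ : Q.real S ≤ Q.real T := measureReal_mono hST
        gcongr
        exact (hPQ S hS).trans (by gcongr)
    _ = Real.exp ε * ((1 - ω) * Q.real T) + ((1 - ω) * δ + ω * U.real S) := by ring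
    _ ≤ Real.exp ε * ((1 - ω) * Q.real T) + Real.exp ε * (ω * U.real T) := by
        gcongr
        exact hgap.trans (le_mul_of_one_le_left (by positivity) (Real.one_le_exp hε))
    _ = Real.exp ε * ((1 - ω) * Q.real T + ω * U.real T) := by ring

theorem IsApproxLE.mixture_of_zero [IsFiniteMeasure P] [IsFiniteMeasure Q] [IsFiniteMeasure U]
    (hPQ : IsApproxLE ε 0 P Q) (hε : 0 ≤ ε) (hω : 0 ≤ ω) (hω1 : ω ≤ 1) :
    IsApproxLE ε 0 (mixture ω P U) (mixture ω Q U) := fun S hS => by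
  rw [add_zero]
  exact hPQ.mixture_real_le hε hω hω1 hS subset_rfl (by simp)

theorem lintegral_ofReal_le_of_meas_lt_le {c : ℝ≥0∞} (hc : c ≠ ∞) {f g : Y → ℝ}
    (hf0 : 0 ≤ f) (hg0 : 0 ≤ g) (hf : Measurable f) (hg : Measurable g)
    (h : ∀ t, 0 < t → P {x | t < f x} ≤ c * Q {x | t ≤ g x}) :
    ∫⁻ x, ENNReal.ofReal (f x) ∂P ≤ c * ∫⁻ x, ENNReal.ofReal (g x) ∂Q := by
  rw [lintegral_eq_lintegral_meas_lt _ (ae_of_all _ hf0) hf.aemeasurable,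
    lintegral_eq_lintegral_meas_le _ (ae_of_all _ hg0) hg.aemeasurable,
    ← lintegral_const_mul' _ _ hc]
  exact setLIntegral_mono' measurableSet_Ioi h

theorem conv_apply [AddMonoid Y] [MeasurableAdd₂ Y] [SFinite Q] {S : Set Y}
    (hS : MeasurableSet S) : (P ∗ Q) S = ∫⁻ x, Q ((x + ·) ⁻¹' S) ∂P := by
  rw [Measure.conv, Measure.map_apply measurable_add hS, Measure.prod_apply (measurable_add hS)]
  rfl

theorem IsApproxLE.conv_of_zero [AddMonoid Y] [MeasurableAdd₂ Y] [IsFiniteMeasure P]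
    [IsFiniteMeasure Q] [IsFiniteMeasure U] (hPQ : IsApproxLE ε 0 P Q) :
    IsApproxLE ε 0 (P ∗ U) (Q ∗ U) := by
  rw [isApproxLE_zero_iff] at hPQ ⊢
  rw [← Measure.conv_smul_left]
  exact Measure.map_mono (Measure.prod_mono hPQ le_rfl) measurable_add

end ApproxLE

section Smoothing

variable {E : Type*} [MeasureSpace E] [NormedAddCommGroup E] [NormedSpace ℝ E]
  [FiniteDimensional ℝ E] [BorelSpace E] [(volume : Measure E).IsAddHaarMeasure]
  {Θ : Set E} {p : Seminorm ℝ E} {P Q : Measure E} [IsProbabilityMeasure P]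
  [IsProbabilityMeasure Q] {ε δ ω r D K : ℝ}

theorem IsApproxLE.mixture_superlevel_le (hPQ : IsApproxLE ε δ P Q) (hε : 0 ≤ ε) (hδ : 0 ≤ δ)
    (hω : 0 ≤ ω) (hω1 : ω ≤ 1) (hp : Continuous p) (hΘ : Convex ℝ Θ) (h0 : volume Θ ≠ 0)
    (hfin : volume Θ ≠ ∞) (hP : ∀ᵐ x ∂P, x ∈ Θ) (hQ : ∀ᵐ x ∂Q, x ∈ Θ)
    (hD : ∀ x ∈ Θ, ∀ y ∈ Θ, p (x - y) ≤ D) (hr : 0 ≤ r)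
    (hrδ : δ ≤ ω * r ^ Module.finrank ℝ E) {h : E → ℝ} (hh : LogLipschitz K p h) (hK : 0 ≤ K)
    (t : ℝ) :
    (mixture ω P (unif Θ)).real {x | t < h x} ≤
      Real.exp ε * (mixture ω Q (unif Θ)).real
        {x | t ≤ Real.exp (2 * (K * (r * D))) * h x} := by
  have := isProbabilityMeasure_unif h0 hfin
  have := isProbabilityMeasure_mixture (P := P) (U := unif Θ) hω hω1
  have := isProbabilityMeasure_mixture (P := Q) (U := unif Θ) hω hω1
  obtain ⟨x, hx⟩ := nonempty_of_measure_ne_zero h0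
  have hD0 : 0 ≤ D := (apply_nonneg p _).trans (hD x hx x hx)
  rcases hh.unif_superlevel_trichotomy hK hp hΘ h0 hfin hD hr t with hlow | hhigh | hgap
  · have hnull : mixture ω P (unif Θ) {x | t < h x} = 0 :=
      measure_mono_null (fun x hx hxΘ => (hlow x hxΘ).not_gt hx)
        (ae_mixture hP (ae_mem_unif hΘ))
    rw [measureReal_def, hnull, ENNReal.toReal_zero]
    positivity
  · have hT : MeasurableSet {x | t ≤ Real.exp (2 * (K * (r * D))) * h x} :=
      (isClosed_le continuous_const
        (continuous_const.mul (hh.continuous hp))).measurableSet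
    have hfull : mixture ω Q (unif Θ) {x | t ≤ Real.exp (2 * (K * (r * D))) * h x} = 1 :=
      (mem_ae_iff_prob_eq_one hT).1 ((ae_mixture hQ (ae_mem_unif hΘ)).mono hhigh)
    rw [measureReal_def _ {x | t ≤ _}, hfull, ENNReal.toReal_one, mul_one]
    exact measureReal_le_one.trans (Real.one_le_exp hε)
  · refine hPQ.mixture_real_le hε hω hω1
      (isOpen_lt continuous_const (hh.continuous hp)).measurableSet
      (hh.superlevel_subset (by positivity) t) ?_
    have habsorb : (1 - ω) * δ ≤ ω * r ^ Module.finrank ℝ E :=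
      (mul_le_of_le_one_left hδ (sub_le_self 1 hω)).trans hrδ
    linarith [mul_le_mul_of_nonneg_left hgap hω]

theorem IsApproxLE.mixture_conv (hPQ : IsApproxLE ε δ P Q) (hε : 0 ≤ ε) (hδ : 0 ≤ δ)
    (hω : 0 ≤ ω) (hω1 : ω ≤ 1) (hp : Continuous p) (hΘ : Convex ℝ Θ) (h0 : volume Θ ≠ 0)
    (hfin : volume Θ ≠ ∞) (hP : ∀ᵐ x ∂P, x ∈ Θ) (hQ : ∀ᵐ x ∂Q, x ∈ Θ)
    (hD : ∀ x ∈ Θ, ∀ y ∈ Θ, p (x - y) ≤ D) (hr : 0 ≤ r)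
    (hrδ : δ ≤ ω * r ^ Module.finrank ℝ E) {L : Measure E} [IsFiniteMeasure L] (hK : 0 ≤ K)
    (hL : ∀ S, MeasurableSet S → LogLipschitz K p fun x => L.real ((x + ·) ⁻¹' S)) :
    IsApproxLE (ε + 2 * (K * (r * D))) 0
      (mixture ω P (unif Θ) ∗ L) (mixture ω Q (unif Θ) ∗ L) := by
  have := isProbabilityMeasure_unif h0 hfin
  have := isProbabilityMeasure_mixture (P := P) (U := unif Θ) hω hω1
  have := isProbabilityMeasure_mixture (P := Q) (U := unif Θ) hω hω1
  refine isApproxLE_zero_iff.2 (Measure.le_iff.2 fun S hS => ?_)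
  have hh := hL S hS
  have hmeas := (hh.continuous hp).measurable
  have hreal : ∀ x, L ((x + ·) ⁻¹' S) = ENNReal.ofReal (L.real ((x + ·) ⁻¹' S)) :=
    fun _ => (ofReal_measureReal (by finiteness)).symm
  rw [Measure.smul_apply, smul_eq_mul, conv_apply hS, conv_apply hS]
  simp_rw [hreal]
  rw [Real.exp_add, ENNReal.ofReal_mul (Real.exp_pos _).le, mul_assoc,
    ← lintegral_const_mul _ hmeas.ennreal_ofReal]
  simp_rw [← ENNReal.ofReal_mul (Real.exp_pos (2 * (K * (r * D)))).le]
  refine lintegral_ofReal_le_of_meas_lt_le ENNReal.ofReal_ne_top hh.nonneg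
    (fun x => mul_nonneg (Real.exp_pos _).le (hh.nonneg x)) hmeas (hmeas.const_mul _) fun t _ => ?_
  rw [← ofReal_measureReal (μ := mixture ω P (unif Θ)),
    ← ofReal_measureReal (μ := mixture ω Q (unif Θ)), ← ENNReal.ofReal_mul (Real.exp_pos _).le]
  exact ENNReal.ofReal_le_ofReal (hPQ.mixture_superlevel_le hε hδ hω hω1 hp hΘ h0 hfin hP hQ hD hr
    hrδ hh hK t)

end Smoothing

section Perturb

variable {d : ℕ} {ω : ℝ} {μ ν L : Measure (Fin d → ℝ)}

/-- The joint law of `x` and its perturbation when `x` has law `μ`: `purifyJoint` with an arbitrary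
replacement law `ν` and an arbitrary noise law `L`. -/
noncomputable def perturbJoint (ω : ℝ) (μ ν L : Measure (Fin d → ℝ)) :
    Measure ((Fin d → ℝ) × (Fin d → ℝ)) :=
  (μ.prod ((unif (Set.Icc (0 : ℝ) 1)).prod (ν.prod L))).map
    fun s => (s.1, purifyPoint ω s.1 s.2.1 s.2.2.1 s.2.2.2)

theorem measurable_purifyPoint :
    Measurable fun s : (Fin d → ℝ) × ℝ × (Fin d → ℝ) × (Fin d → ℝ) =>
      purifyPoint ω s.1 s.2.1 s.2.2.1 s.2.2.2 := by
  unfold purifyPoint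
  exact (Measurable.ite (measurableSet_le (by fun_prop) (by fun_prop)) (by fun_prop)
    (by fun_prop)).add (by fun_prop)

theorem isProbabilityMeasure_unif_Icc :
    IsProbabilityMeasure (unif (Set.Icc (0 : ℝ) 1)) :=
  isProbabilityMeasure_unif (by simp) (by simp)

theorem unif_Icc_Iic (hω1 : ω ≤ 1) :
    unif (Set.Icc (0 : ℝ) 1) (Set.Iic ω) = ENNReal.ofReal ω := by
  have hcap : Set.Icc (0 : ℝ) 1 ∩ Set.Iic ω = Set.Icc 0 ω := by
    rw [← Set.Ici_inter_Iic, Set.inter_assoc, Set.Iic_inter_Iic, min_eq_right hω1,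
      Set.Ici_inter_Iic]
  rw [unif, cond_apply measurableSet_Icc, hcap]
  simp

theorem lintegral_unif_Icc_ite (hω : 0 ≤ ω) (hω1 : ω ≤ 1) (a b : ℝ≥0∞) :
    ∫⁻ t, (if t ≤ ω then a else b) ∂unif (Set.Icc (0 : ℝ) 1) =
      ENNReal.ofReal (1 - ω) * b + ENNReal.ofReal ω * a := by
  have := isProbabilityMeasure_unif_Icc
  have hcompl : unif (Set.Icc (0 : ℝ) 1) (Set.Iic ω)ᶜ = ENNReal.ofReal (1 - ω) := by
    rw [prob_compl_eq_one_sub measurableSet_Iic, unif_Icc_Iic hω1,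
      ENNReal.ofReal_sub _ hω, ENNReal.ofReal_one]
  calc ∫⁻ t, (if t ≤ ω then a else b) ∂unif (Set.Icc (0 : ℝ) 1)
      = ∫⁻ t, (Set.Iic ω).piecewise (fun _ => a) (fun _ => b) t ∂unif (Set.Icc (0 : ℝ) 1) := rfl
    _ = a * ENNReal.ofReal ω + b * ENNReal.ofReal (1 - ω) := by
        rw [lintegral_piecewise measurableSet_Iic, setLIntegral_const, setLIntegral_const,
          unif_Icc_Iic hω1, hcompl]
    _ = _ := by ring

theorem lintegral_purifyPoint [IsProbabilityMeasure ν] [IsProbabilityMeasure L]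
    (hω : 0 ≤ ω) (hω1 : ω ≤ 1) {f : (Fin d → ℝ) → ℝ≥0∞} (hf : Measurable f) (x : Fin d → ℝ) :
    ∫⁻ s, f (purifyPoint ω x s.1 s.2.1 s.2.2) ∂(unif (Set.Icc (0 : ℝ) 1)).prod (ν.prod L) =
      ENNReal.ofReal (1 - ω) * ∫⁻ z, f (x + z) ∂L +
        ENNReal.ofReal ω * ∫⁻ y, ∫⁻ z, f (y + z) ∂L ∂ν := by
  have hfx : Measurable fun s : ℝ × (Fin d → ℝ) × (Fin d → ℝ) =>
      f (purifyPoint ω x s.1 s.2.1 s.2.2) :=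
    (hf.comp measurable_purifyPoint).comp measurable_prodMk_left
  rw [lintegral_prod _ hfx.aemeasurable, ← lintegral_unif_Icc_ite hω hω1]
  refine lintegral_congr fun t => ?_
  refine (lintegral_prod _ (hfx.comp measurable_prodMk_left).aemeasurable).trans ?_
  split_ifs with ht <;> simp [purifyPoint, ht]

theorem map_snd_perturbJoint [IsProbabilityMeasure μ] [IsProbabilityMeasure ν]
    [IsProbabilityMeasure L] (hω : 0 ≤ ω) (hω1 : ω ≤ 1) :
    (perturbJoint ω μ ν L).map Prod.snd = mixture ω μ ν ∗ L := by
  have := isProbabilityMeasure_unif_Icc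
  refine Measure.ext_of_lintegral _ fun f hf => ?_
  have hfp : Measurable fun s : (Fin d → ℝ) × ℝ × (Fin d → ℝ) × (Fin d → ℝ) =>
      f (purifyPoint ω s.1 s.2.1 s.2.2.1 s.2.2.2) := hf.comp measurable_purifyPoint
  have hg : Measurable fun x => ∫⁻ z, f (x + z) ∂L :=
    Measurable.lintegral_prod_right' (f := fun s => f (s.1 + s.2)) (by fun_prop)
  calc ∫⁻ p, f p ∂(perturbJoint ω μ ν L).map Prod.snd
      = ∫⁻ s, f (purifyPoint ω s.1 s.2.1 s.2.2.1 s.2.2.2)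
          ∂μ.prod ((unif (Set.Icc (0 : ℝ) 1)).prod (ν.prod L)) := by
        rw [lintegral_map hf measurable_snd, perturbJoint,
          lintegral_map (f := fun p => f p.2) (by fun_prop)
            (measurable_fst.prodMk measurable_purifyPoint)]
    _ = ∫⁻ x, (ENNReal.ofReal (1 - ω) * ∫⁻ z, f (x + z) ∂L +
          ENNReal.ofReal ω * ∫⁻ y, ∫⁻ z, f (y + z) ∂L ∂ν) ∂μ := by
        rw [lintegral_prod _ hfp.aemeasurable]
        exact lintegral_congr fun x => lintegral_purifyPoint hω hω1 hf x
    _ = ∫⁻ x, ∫⁻ z, f (x + z) ∂L ∂mixture ω μ ν := by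
        rw [lintegral_add_right _ measurable_const, lintegral_const_mul _ hg, lintegral_const,
          measure_univ, mul_one, mixture, lintegral_add_measure, lintegral_smul_measure,
          lintegral_smul_measure, smul_eq_mul, smul_eq_mul]
    _ = ∫⁻ p, f p ∂(mixture ω μ ν ∗ L) := (Measure.lintegral_conv hf).symm

end Perturb

section Privacy

variable {d : ℕ} {q : ℝ≥0∞} {R ε' δ ω : ℝ} {Θ : Set (Fin d → ℝ)}

theorem logLipschitz_laplaceVec {b : ℝ} (hb : 0 < b) {S : Set (Fin d → ℝ)} (hS : MeasurableSet S) :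
    LogLipschitz b⁻¹ (lqSeminorm 1 d) fun x => (laplaceVec d b).real ((x + ·) ⁻¹' S) where
  nonneg _ := measureReal_nonneg
  le_exp_mul x y := by
    have := isProbabilityMeasure_laplaceVec (d := d) hb.le
    have hSy := measurable_const_add y hS
    have hpre : ((x - y) + ·) ⁻¹' ((y + ·) ⁻¹' S) = (x + ·) ⁻¹' S := by
      ext z
      simp only [Set.mem_preimage, ← add_assoc, add_sub_cancel]
    have hle := map_const_add_laplaceVec_le hb (x - y) ((y + ·) ⁻¹' S)
    rw [Measure.map_apply (measurable_const_add _) hSy, hpre, Measure.smul_apply, smul_eq_mul,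
      div_eq_inv_mul] at hle
    simpa [ENNReal.toReal_mul, (Real.exp_pos _).le, measureReal_def, lqSeminorm_apply]
      using ENNReal.toReal_mono (by finiteness) hle

theorem noiseScale_nonneg (hR : 0 ≤ R) (hδ : 0 ≤ δ) (hω : 0 ≤ ω) (hε' : 0 ≤ ε') :
    0 ≤ 2 * noiseDelta d q R δ ω / ε' := by
  unfold noiseDelta
  positivity

theorem noiseDelta_pos (hd : 0 < d) (hR : 0 < R) (hδ : 0 < δ) (hω : 0 < ω) :
    0 < noiseDelta d q R δ ω := by
  unfold noiseDelta
  positivity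

theorem rpow_mul_le_noiseDelta (hd : 1 ≤ d) (hR : 0 ≤ R) (hδ : 0 ≤ δ) (hω : 0 ≤ ω) :
    (δ / ω) ^ (1 / (d : ℝ)) * ((d : ℝ) ^ (1 - (q⁻¹).toReal) * R) ≤ noiseDelta d q R δ ω := by
  have htwo : (2 : ℝ) ^ (1 / (d : ℝ)) ≤ 2 :=
    Real.rpow_le_self_of_one_le one_le_two
      ((div_le_one (by positivity)).2 (by exact_mod_cast hd))
  have hδω : δ / ω = 2 * (δ / (2 * ω)) := by field_simp
  calc (δ / ω) ^ (1 / (d : ℝ)) * ((d : ℝ) ^ (1 - (q⁻¹).toReal) * R)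
      ≤ 2 * (δ / (2 * ω)) ^ (1 / (d : ℝ)) * ((d : ℝ) ^ (1 - (q⁻¹).toReal) * R) := by
        rw [hδω, Real.mul_rpow zero_le_two (by positivity)]
        gcongr
    _ = noiseDelta d q R δ ω := by
        unfold noiseDelta
        ring

theorem purify_eq_conv {μ : Measure (Fin d → ℝ)} [IsProbabilityMeasure μ]
    [IsProbabilityMeasure (unif Θ)] (hR : 0 ≤ R) (hδ : 0 ≤ δ) (hε' : 0 ≤ ε') (hω : 0 ≤ ω)
    (hω1 : ω ≤ 1) :
    purify q R ε' δ ω Θ μ =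
      mixture ω μ (unif Θ) ∗ laplaceVec d (2 * noiseDelta d q R δ ω / ε') := by
  have hb : 0 ≤ 2 * noiseDelta d q R δ ω / ε' := noiseScale_nonneg hR hδ hω hε'
  have := isProbabilityMeasure_laplaceVec (d := d) hb
  exact map_snd_perturbJoint hω hω1

theorem IsApproxLE.purify {P Q : Measure (Fin d → ℝ)} [IsProbabilityMeasure P]
    [IsProbabilityMeasure Q] {ε : ℝ} (hPQ : IsApproxLE ε δ P Q) (hd : 1 ≤ d) (hq : 1 ≤ q)
    (hR : 0 < R) (hΘ : Convex ℝ Θ) (h0 : volume Θ ≠ 0)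
    (hdiam : ∀ x ∈ Θ, ∀ y ∈ Θ, lqNorm q (x - y) ≤ R) (hε : 0 ≤ ε) (hδ : 0 ≤ δ) (hε' : 0 < ε')
    (hω : 0 < ω) (hω1 : ω ≤ 1) (hP : ∀ᵐ x ∂P, x ∈ Θ) (hQ : ∀ᵐ x ∂Q, x ∈ Θ) :
    IsApproxLE (ε + ε') 0 (purify q R ε' δ ω Θ P) (purify q R ε' δ ω Θ Q) := by
  have : Fact (1 ≤ q) := ⟨hq⟩
  have hfin := volume_ne_top_of_lqNorm_sub_le hdiam
  have := isProbabilityMeasure_unif h0 hfin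
  have := isProbabilityMeasure_mixture (P := P) (U := unif Θ) hω.le hω1
  have := isProbabilityMeasure_mixture (P := Q) (U := unif Θ) hω.le hω1
  have hb : 0 ≤ 2 * noiseDelta d q R δ ω / ε' := noiseScale_nonneg hR.le hδ hω.le hε'.le
  have := isProbabilityMeasure_laplaceVec (d := d) hb
  rw [purify_eq_conv hR.le hδ hε'.le hω.le hω1, purify_eq_conv hR.le hδ hε'.le hω.le hω1]
  rcases hδ.eq_or_lt with rfl | hδ0
  · exact ((hPQ.mixture_of_zero hε hω.le hω1).conv_of_zero).mono (by linarith)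
  · have hΔ0 : 0 < noiseDelta d q R δ ω := noiseDelta_pos hd hR hδ0 hω
    set r := (δ / ω) ^ (1 / (d : ℝ)) with hr
    have hrδ : δ ≤ ω * r ^ Module.finrank ℝ (Fin d → ℝ) := by
      rw [Module.finrank_fin_fun, hr, one_div,
        Real.rpow_inv_natCast_pow (by positivity) (by positivity), mul_div_cancel₀ _ hω.ne']
    have hdiam_one : ∀ x ∈ Θ, ∀ y ∈ Θ, lqNorm 1 (x - y) ≤ (d : ℝ) ^ (1 - (q⁻¹).toReal) * R :=
      fun x hx y hy => (lqNorm_one_le hq _).trans (by gcongr; exact hdiam x hx y hy)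
    have hexp : 2 * ((2 * noiseDelta d q R δ ω / ε')⁻¹ *
        (r * ((d : ℝ) ^ (1 - (q⁻¹).toReal) * R))) ≤ ε' :=
      calc 2 * ((2 * noiseDelta d q R δ ω / ε')⁻¹ * (r * ((d : ℝ) ^ (1 - (q⁻¹).toReal) * R)))
          ≤ 2 * ((2 * noiseDelta d q R δ ω / ε')⁻¹ * noiseDelta d q R δ ω) := by
            gcongr
            exact rpow_mul_le_noiseDelta hd hR.le hδ hω.le
        _ = ε' := by field_simp
    refine (hPQ.mixture_conv hε hδ hω.le hω1 (continuous_lqSeminorm 1) hΘ h0 hfin hP hQ hdiam_one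
      (by positivity) hrδ (by positivity)
      fun S hS => logLipschitz_laplaceVec (by positivity) hS).mono (by gcongr)

end Privacy

section Utility

variable {d : ℕ} {ω C : ℝ} {Θ : Set (Fin d → ℝ)} {μ ν L : Measure (Fin d → ℝ)}
  {p : Seminorm ℝ (Fin d → ℝ)}

theorem seminorm_purifyPoint_sub_le {x y : Fin d → ℝ} (hxy : p (y - x) ≤ C) (t : ℝ)
    (z : Fin d → ℝ) :
    p (purifyPoint ω x t y z - x) ≤ (Set.Iic ω).indicator (fun _ => C) t + p z := by
  unfold purifyPoint
  by_cases ht : t ≤ ω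
  · rw [if_pos ht, Set.indicator_of_mem (Set.mem_Iic.2 ht), add_sub_right_comm]
    exact (map_add_le_add p _ _).trans (by gcongr)
  · rw [if_neg ht, Set.indicator_of_notMem (by simpa using ht), add_sub_cancel_left, zero_add]

theorem integral_unif_Icc_indicator_const (hω : 0 ≤ ω) (hω1 : ω ≤ 1) (C : ℝ) :
    ∫ t, (Set.Iic ω).indicator (fun _ => C) t ∂unif (Set.Icc (0 : ℝ) 1) = ω * C := by
  rw [integral_indicator_const _ measurableSet_Iic, measureReal_def, unif_Icc_Iic hω1,
    ENNReal.toReal_ofReal hω, smul_eq_mul]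

theorem ae_seminorm_purifyPoint_sub_le (hμ : ∀ᵐ x ∂μ, x ∈ Θ) (hν : ∀ᵐ y ∂ν, y ∈ Θ)
    (hC : ∀ x ∈ Θ, ∀ y ∈ Θ, p (x - y) ≤ C) :
    ∀ᵐ s ∂μ.prod ((unif (Set.Icc (0 : ℝ) 1)).prod (ν.prod L)),
      p (purifyPoint ω s.1 s.2.1 s.2.2.1 s.2.2.2 - s.1) ≤
        (Set.Iic ω).indicator (fun _ => C) s.2.1 + p s.2.2.2 := by
  have := isProbabilityMeasure_unif_Icc
  have hx : ∀ᵐ s ∂μ.prod ((unif (Set.Icc (0 : ℝ) 1)).prod (ν.prod L)), s.1 ∈ Θ :=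
    Measure.quasiMeasurePreserving_fst.ae hμ
  have hy : ∀ᵐ s ∂μ.prod ((unif (Set.Icc (0 : ℝ) 1)).prod (ν.prod L)), s.2.2.1 ∈ Θ :=
    (Measure.quasiMeasurePreserving_fst.comp (Measure.quasiMeasurePreserving_snd.comp
      Measure.quasiMeasurePreserving_snd)).ae hν
  filter_upwards [hx, hy] with s hsx hsy
  exact seminorm_purifyPoint_sub_le (hC _ hsy _ hsx) _ _

theorem integral_seminorm_perturbJoint_le [IsProbabilityMeasure μ] [IsProbabilityMeasure ν]
    [IsProbabilityMeasure L] (hp : Continuous p) (hω : 0 ≤ ω) (hω1 : ω ≤ 1) (hμ : ∀ᵐ x ∂μ, x ∈ Θ)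
    (hν : ∀ᵐ y ∂ν, y ∈ Θ) (hC : ∀ x ∈ Θ, ∀ y ∈ Θ, p (x - y) ≤ C) (hL : Integrable p L) :
    Integrable (fun s => p (s.2 - s.1)) (perturbJoint ω μ ν L) ∧
      ∫ s, p (s.2 - s.1) ∂perturbJoint ω μ ν L ≤ ω * C + ∫ z, p z ∂L := by
  have := isProbabilityMeasure_unif_Icc
  have hmap : Measurable fun s : (Fin d → ℝ) × ℝ × (Fin d → ℝ) × (Fin d → ℝ) =>
      (s.1, purifyPoint ω s.1 s.2.1 s.2.2.1 s.2.2.2) :=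
    measurable_fst.prodMk measurable_purifyPoint
  have hcont : Continuous fun s : (Fin d → ℝ) × (Fin d → ℝ) => p (s.2 - s.1) := by fun_prop
  have hbound := ae_seminorm_purifyPoint_sub_le (ω := ω) (L := L) hμ hν hC
  have hreplace : Integrable ((Set.Iic ω).indicator fun _ => C) (unif (Set.Icc (0 : ℝ) 1)) :=
    (integrable_const C).indicator measurableSet_Iic
  have hreplace' := (hreplace.comp_fst (ν.prod L)).comp_snd μ
  have hnoise := ((hL.comp_snd ν).comp_snd (unif (Set.Icc (0 : ℝ) 1))).comp_snd μ
  have hint := (hreplace'.add hnoise).mono'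
    (hcont.measurable.comp hmap).aestronglyMeasurable (by
      filter_upwards [hbound] with s hs
      exact (Real.norm_of_nonneg (apply_nonneg p _)).trans_le hs)
  refine ⟨(integrable_map_measure hcont.aestronglyMeasurable hmap.aemeasurable).2 hint, ?_⟩
  rw [perturbJoint, integral_map hmap.aemeasurable hcont.aestronglyMeasurable]
  refine (integral_mono_ae hint (hreplace'.add hnoise) hbound).trans_eq ?_
  rw [integral_add' hreplace' hnoise, ← integral_unif_Icc_indicator_const hω hω1 C]
  congr 1
  · rw [integral_fun_snd fun u : ℝ × (Fin d → ℝ) × (Fin d → ℝ) =>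
      (Set.Iic ω).indicator (fun _ => C) u.1, integral_fun_fst]
    simp only [probReal_univ, one_smul]
  · rw [integral_fun_snd fun u : ℝ × (Fin d → ℝ) × (Fin d → ℝ) => p u.2.2,
      integral_fun_snd fun u : (Fin d → ℝ) × (Fin d → ℝ) => p u.2, integral_fun_snd]
    simp only [probReal_univ, one_smul]

end Utility

section Gamma

theorem Gamma_natCast_le {n : ℕ} (hn : n ≠ 0) : Real.Gamma n ≤ (n : ℝ) ^ ((n : ℝ) - 1) := by
  obtain ⟨m, rfl⟩ := Nat.exists_eq_succ_of_ne_zero hn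
  rw [Nat.cast_succ, Real.Gamma_nat_eq_factorial, add_sub_cancel_right, Real.rpow_natCast]
  exact_mod_cast (Nat.factorial_le_pow m).trans (Nat.pow_le_pow_left (Nat.le_succ m) m)

/-- Log-convexity of `Γ` between `n` and `n + 1`. -/
theorem Gamma_natCast_add_le {n : ℕ} (hn : n ≠ 0) {x : ℝ} (hx0 : 0 < x) (hx1 : x ≤ 1) :
    Real.Gamma (n + x) ≤ Real.Gamma n * (n : ℝ) ^ x := by
  have hnpos : 0 < (n : ℝ) := by positivity
  have hΓn := Real.Gamma_pos_of_pos hnpos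
  have hlog := Real.BohrMollerup.f_add_nat_le Real.convexOn_log_Gamma
    (fun {y} hy => by
      simp only [Function.comp_apply]
      rw [Real.Gamma_add_one hy.ne', Real.log_mul hy.ne' (Real.Gamma_pos_of_pos hy).ne', add_comm])
    hn hx0 hx1
  simp only [Function.comp_apply] at hlog
  rw [← Real.log_le_log_iff (Real.Gamma_pos_of_pos (by positivity)) (by positivity),
    Real.log_mul hΓn.ne' (by positivity), Real.log_rpow hnpos]
  exact hlog

theorem Gamma_le_rpow_sub_one {s : ℝ} (hs : 1 ≤ s) : Real.Gamma s ≤ s ^ (s - 1) := by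
  rcases hs.eq_or_lt with rfl | hs1
  · simp
  obtain ⟨n, hn⟩ : ∃ n : ℕ, ⌈s⌉₊ = n + 1 :=
    Nat.exists_eq_succ_of_ne_zero (Nat.ceil_pos.2 (by linarith)).ne'
  have hns : (n : ℝ) < s := Nat.lt_ceil.1 (by omega)
  have hsn : s ≤ n + 1 := by exact_mod_cast hn ▸ Nat.le_ceil s
  have hn0 : n ≠ 0 := by
    rintro rfl
    norm_num at hsn
    linarith
  have hnpos : 0 < (n : ℝ) := by positivity
  calc Real.Gamma s = Real.Gamma (n + (s - n)) := by rw [add_sub_cancel]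
    _ ≤ Real.Gamma n * (n : ℝ) ^ (s - n) :=
        Gamma_natCast_add_le hn0 (by linarith) (by linarith)
    _ ≤ (n : ℝ) ^ ((n : ℝ) - 1) * (n : ℝ) ^ (s - n) := by
        gcongr
        exact Gamma_natCast_le hn0
    _ = (n : ℝ) ^ (s - 1) := by
        rw [← Real.rpow_add hnpos]
        ring_nf
    _ ≤ s ^ (s - 1) := by
        have : 0 ≤ s - 1 := by linarith
        gcongr

theorem Gamma_add_one_le_rpow_self {s : ℝ} (hs : 1 ≤ s) : Real.Gamma (s + 1) ≤ s ^ s := by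
  have hs0 : 0 < s := by linarith
  calc Real.Gamma (s + 1) = s * Real.Gamma s := Real.Gamma_add_one hs0.ne'
    _ ≤ s * s ^ (s - 1) := by
        gcongr
        exact Gamma_le_rpow_sub_one hs
    _ = s ^ s := by rw [mul_comm, ← Real.rpow_add_one hs0.ne', sub_add_cancel]

end Gamma

section Moments

variable {Y : Type*} [MeasurableSpace Y] {P : Measure Y} [IsProbabilityMeasure P] {f : Y → ℝ}
  {s : ℝ}

theorem integrable_of_integrable_rpow (hs : 1 ≤ s) (hf0 : 0 ≤ f) (hf : AEStronglyMeasurable f P)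
    (hfs : Integrable (fun x => f x ^ s) P) : Integrable f P := by
  refine ((integrable_const (1 : ℝ)).add hfs).mono' hf (ae_of_all _ fun x => ?_)
  rw [Real.norm_of_nonneg (hf0 x), Pi.add_apply]
  rcases le_total (f x) 1 with h1 | h1
  · linarith [Real.rpow_nonneg (hf0 x) s]
  · linarith [Real.self_le_rpow_of_one_le h1 hs]

theorem rpow_integral_le_integral_rpow (hs : 1 ≤ s) (hf0 : 0 ≤ f) (hf : Integrable f P)
    (hfs : Integrable (fun x => f x ^ s) P) : (∫ x, f x ∂P) ^ s ≤ ∫ x, f x ^ s ∂P :=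
  (convexOn_rpow hs).map_integral_le
    (Real.continuous_rpow_const (by linarith)).continuousOn isClosed_Ici
    (ae_of_all P hf0) hf hfs

variable {d : ℕ} {q : ℝ≥0∞} {b : ℝ}

theorem integrable_lqNorm_rpow_laplaceVec (hb : 0 ≤ b) (hq0 : q ≠ 0) (hq : q ≠ ∞) :
    Integrable (fun z => lqNorm q z ^ q.toReal) (laplaceVec d b) := by
  have := isProbabilityMeasure_laplace hb
  simp_rw [lqNorm_rpow_eq_sum hq0 hq]
  exact integrable_finsetSum _ fun i _ =>
    integrable_comp_eval (μ := fun _ : Fin d => laplace b) (i := i)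
      (integrable_abs_rpow_laplace hb (by linarith [ENNReal.toReal_nonneg (a := q)]))

theorem integral_lqNorm_rpow_laplaceVec (hb : 0 ≤ b) (hq0 : q ≠ 0) (hq : q ≠ ∞) :
    ∫ z, lqNorm q z ^ q.toReal ∂laplaceVec d b =
      d * (b ^ q.toReal * Real.Gamma (q.toReal + 1)) := by
  have := isProbabilityMeasure_laplace hb
  have hs : -1 < q.toReal := by linarith [ENNReal.toReal_nonneg (a := q)]
  have hi := integrable_abs_rpow_laplace hb hs
  have hint : ∀ i : Fin d, Integrable (fun z : Fin d → ℝ => |z i| ^ q.toReal) (laplaceVec d b) :=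
    fun i => integrable_comp_eval (μ := fun _ : Fin d => laplace b) (i := i) hi
  have hcoord : ∀ i : Fin d, ∫ z : Fin d → ℝ, |z i| ^ q.toReal ∂laplaceVec d b =
      b ^ q.toReal * Real.Gamma (q.toReal + 1) := fun i =>
    (integral_comp_eval (μ := fun _ : Fin d => laplace b) (i := i)
      hi.aestronglyMeasurable).trans (integral_abs_rpow_laplace hb hs)
  simp_rw [lqNorm_rpow_eq_sum hq0 hq]
  rw [integral_finsetSum _ fun i _ => hint i]
  simp [hcoord]

theorem integrable_lqNorm_laplaceVec (hb : 0 ≤ b) (hq1 : 1 ≤ q) (hq : q ≠ ∞) :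
    Integrable (lqNorm q) (laplaceVec d b) := by
  have : Fact (1 ≤ q) := ⟨hq1⟩
  have := isProbabilityMeasure_laplaceVec (d := d) hb
  exact integrable_of_integrable_rpow (one_le_toReal hq1 hq) (fun _ => norm_nonneg _)
    (continuous_lqSeminorm q).aestronglyMeasurable
    (integrable_lqNorm_rpow_laplaceVec hb (zero_lt_one.trans_le hq1).ne' hq)

theorem integral_lqNorm_one_laplaceVec (hb : 0 ≤ b) :
    ∫ z, lqNorm 1 z ∂laplaceVec d b = d * b := by
  simpa [one_add_one_eq_two] using
    integral_lqNorm_rpow_laplaceVec (d := d) hb one_ne_zero ENNReal.one_ne_top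

theorem integral_lqNorm_laplaceVec_le (hb : 0 ≤ b) (hq1 : 1 ≤ q) (hq : q ≠ ∞) :
    ∫ z, lqNorm q z ∂laplaceVec d b ≤ (d : ℝ) ^ (1 / q.toReal) * (b * q.toReal) := by
  have : Fact (1 ≤ q) := ⟨hq1⟩
  have := isProbabilityMeasure_laplaceVec (d := d) hb
  have hs := one_le_toReal hq1 hq
  have hs0 : 0 < q.toReal := by linarith
  have hq0 : q ≠ 0 := (zero_lt_one.trans_le hq1).ne'
  have hnn : ∀ z : Fin d → ℝ, 0 ≤ lqNorm q z := fun z => norm_nonneg _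
  refine (Real.rpow_le_rpow_iff (integral_nonneg hnn) (by positivity) hs0).1 ?_
  calc (∫ z, lqNorm q z ∂laplaceVec d b) ^ q.toReal
      ≤ ∫ z, lqNorm q z ^ q.toReal ∂laplaceVec d b :=
        rpow_integral_le_integral_rpow hs hnn (integrable_lqNorm_laplaceVec hb hq1 hq)
          (integrable_lqNorm_rpow_laplaceVec hb hq0 hq)
    _ = d * (b ^ q.toReal * Real.Gamma (q.toReal + 1)) :=
        integral_lqNorm_rpow_laplaceVec hb hq0 hq
    _ ≤ d * (b ^ q.toReal * q.toReal ^ q.toReal) := by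
        gcongr
        exact Gamma_add_one_le_rpow_self hs
    _ = ((d : ℝ) ^ (1 / q.toReal) * (b * q.toReal)) ^ q.toReal := by
        rw [Real.mul_rpow (by positivity) (by positivity), one_div,
          Real.rpow_inv_rpow (Nat.cast_nonneg d) hs0.ne', Real.mul_rpow hb hs0.le]

end Moments

section PurifyJoint

variable {d : ℕ} {q : ℝ≥0∞} {R ε' δ ω : ℝ} {Θ : Set (Fin d → ℝ)} {μ : Measure (Fin d → ℝ)}
  [IsProbabilityMeasure μ]

theorem integral_lqNorm_purifyJoint_le {p : ℝ≥0∞} (hp : 1 ≤ p) (hΘ : Convex ℝ Θ)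
    (h0 : volume Θ ≠ 0) {C : ℝ} (hC : ∀ x ∈ Θ, ∀ y ∈ Θ, lqNorm p (x - y) ≤ C)
    (hω : 0 ≤ ω) (hω1 : ω ≤ 1) (hμ : ∀ᵐ x ∂μ, x ∈ Θ)
    (hb : 0 ≤ 2 * noiseDelta d q R δ ω / ε')
    (hL : Integrable (lqNorm p) (laplaceVec d (2 * noiseDelta d q R δ ω / ε'))) :
    Integrable (fun s => lqNorm p (s.2 - s.1)) (purifyJoint q R ε' δ ω Θ μ) ∧
      ∫ s, lqNorm p (s.2 - s.1) ∂purifyJoint q R ε' δ ω Θ μ ≤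
        ω * C + ∫ z, lqNorm p z ∂laplaceVec d (2 * noiseDelta d q R δ ω / ε') := by
  have : Fact (1 ≤ p) := ⟨hp⟩
  have := isProbabilityMeasure_unif h0 (volume_ne_top_of_lqNorm_sub_le hC)
  have := isProbabilityMeasure_laplaceVec (d := d) hb
  exact integral_seminorm_perturbJoint_le (continuous_lqSeminorm p) hω hω1 hμ (ae_mem_unif hΘ)
    hC hL

theorem integral_lqNorm_one_purifyJoint_le (hq : 1 ≤ q) (hR : 0 ≤ R) (hΘ : Convex ℝ Θ)
    (h0 : volume Θ ≠ 0) (hdiam : ∀ x ∈ Θ, ∀ y ∈ Θ, lqNorm q (x - y) ≤ R) (hδ : 0 ≤ δ)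
    (hε' : 0 ≤ ε') (hω : 0 ≤ ω) (hω1 : ω ≤ 1) (hμ : ∀ᵐ x ∂μ, x ∈ Θ) :
    Integrable (fun p => lqNorm 1 (p.2 - p.1)) (purifyJoint q R ε' δ ω Θ μ) ∧
      ∫ p, lqNorm 1 (p.2 - p.1) ∂purifyJoint q R ε' δ ω Θ μ ≤
        (d : ℝ) ^ (1 - (q⁻¹).toReal) *
          (ω * R + 4 * R * d / ε' * (δ / (2 * ω)) ^ (1 / (d : ℝ))) := by
  have hb : 0 ≤ 2 * noiseDelta d q R δ ω / ε' := noiseScale_nonneg hR hδ hω hε'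
  have hdiam_one : ∀ x ∈ Θ, ∀ y ∈ Θ, lqNorm 1 (x - y) ≤ (d : ℝ) ^ (1 - (q⁻¹).toReal) * R :=
    fun x hx y hy => (lqNorm_one_le hq _).trans (by gcongr; exact hdiam x hx y hy)
  obtain ⟨hint, hle⟩ := integral_lqNorm_purifyJoint_le le_rfl hΘ h0 hdiam_one hω hω1 hμ hb
    (integrable_lqNorm_laplaceVec hb le_rfl ENNReal.one_ne_top)
  refine ⟨hint, hle.trans_eq ?_⟩
  rw [integral_lqNorm_one_laplaceVec hb, noiseDelta]
  ring

theorem integral_lqNorm_self_purifyJoint_le (hd : 1 ≤ d) (hq : 1 ≤ q) (hq' : q ≠ ∞) (hR : 0 ≤ R)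
    (hΘ : Convex ℝ Θ) (h0 : volume Θ ≠ 0) (hdiam : ∀ x ∈ Θ, ∀ y ∈ Θ, lqNorm q (x - y) ≤ R)
    (hδ : 0 ≤ δ) (hε' : 0 ≤ ε') (hω : 0 ≤ ω) (hω1 : ω ≤ 1) (hμ : ∀ᵐ x ∂μ, x ∈ Θ) :
    Integrable (fun p => lqNorm q (p.2 - p.1)) (purifyJoint q R ε' δ ω Θ μ) ∧
      ∫ p, lqNorm q (p.2 - p.1) ∂purifyJoint q R ε' δ ω Θ μ ≤
        ω * R + 4 * R * d * q.toReal / ε' * (δ / (2 * ω)) ^ (1 / (d : ℝ)) := by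
  have hb : 0 ≤ 2 * noiseDelta d q R δ ω / ε' := noiseScale_nonneg hR hδ hω hε'
  have hsplit : (d : ℝ) ^ (1 / q.toReal) * (d : ℝ) ^ (1 - (q⁻¹).toReal) = d := by
    rw [← Real.rpow_add (by positivity), ENNReal.toReal_inv, one_div, add_sub_cancel,
      Real.rpow_one]
  obtain ⟨hint, hle⟩ := integral_lqNorm_purifyJoint_le hq hΘ h0 hdiam hω hω1 hμ hb
    (integrable_lqNorm_laplaceVec hb hq hq')
  refine ⟨hint, hle.trans ?_⟩
  gcongr
  calc ∫ z, lqNorm q z ∂laplaceVec d (2 * noiseDelta d q R δ ω / ε')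
      ≤ (d : ℝ) ^ (1 / q.toReal) * (2 * noiseDelta d q R δ ω / ε' * q.toReal) :=
        integral_lqNorm_laplaceVec_le hb hq hq'
    _ = (d : ℝ) ^ (1 / q.toReal) * (d : ℝ) ^ (1 - (q⁻¹).toReal) *
          (4 * R * q.toReal / ε' * (δ / (2 * ω)) ^ (1 / (d : ℝ))) := by
        rw [noiseDelta]
        ring
    _ = 4 * R * d * q.toReal / ε' * (δ / (2 * ω)) ^ (1 / (d : ℝ)) := by
        rw [hsplit]
        ring

end PurifyJoint

end Purify

theorem theorem1_general {𝒟 : Type*} (nbr : 𝒟 → 𝒟 → Prop) (d : ℕ) (hd : 1 ≤ d) (q : ℝ≥0∞)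
    (hq : 1 ≤ q) (R : ℝ) (hR : 0 < R) (Θ : Set (Fin d → ℝ)) (hΘ : Convex ℝ Θ)
    (h0 : volume Θ ≠ 0) (hdiam : ∀ x ∈ Θ, ∀ y ∈ Θ, Purify.lqNorm q (x - y) ≤ R)
    (ε δ ε' ω : ℝ) (hε : 0 ≤ ε) (hδ : 0 ≤ δ) (hε' : 0 < ε') (hω : 0 < ω) (hω1 : ω ≤ 1)
    (M : 𝒟 → Measure (Fin d → ℝ)) (hM : ∀ D, IsProbabilityMeasure (M D))
    (hrange : ∀ D, ∀ᵐ x ∂(M D), x ∈ Θ) (hDP : Purify.IsDP nbr M ε δ) :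
    Purify.IsDP nbr (fun D => Purify.purify q R ε' δ ω Θ (M D)) (ε + ε') 0 ∧
    ∀ D,
      (q = 1 →
        Integrable (fun p => Purify.lqNorm 1 (p.2 - p.1))
          (Purify.purifyJoint q R ε' δ ω Θ (M D)) ∧
        ∫ p, Purify.lqNorm 1 (p.2 - p.1) ∂(Purify.purifyJoint q R ε' δ ω Θ (M D)) ≤
          ω * R + 4 * R * d / ε' * (δ / (2 * ω)) ^ (1 / (d : ℝ))) ∧
      (q ≠ ∞ →
        Integrable (fun p => Purify.lqNorm q (p.2 - p.1))
          (Purify.purifyJoint q R ε' δ ω Θ (M D)) ∧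
        ∫ p, Purify.lqNorm q (p.2 - p.1) ∂(Purify.purifyJoint q R ε' δ ω Θ (M D)) ≤
          ω * R + 4 * R * d * q.toReal / ε' * (δ / (2 * ω)) ^ (1 / (d : ℝ))) ∧
      (Integrable (fun p => Purify.lqNorm 1 (p.2 - p.1))
          (Purify.purifyJoint q R ε' δ ω Θ (M D)) ∧
        ∫ p, Purify.lqNorm 1 (p.2 - p.1) ∂(Purify.purifyJoint q R ε' δ ω Θ (M D)) ≤
          (d : ℝ) ^ (1 - (q⁻¹).toReal) *
            (ω * R + 4 * R * d / ε' * (δ / (2 * ω)) ^ (1 / (d : ℝ)))) := by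
  refine ⟨fun D D' hDD' => ?_, fun D => ?_⟩
  · exact Purify.IsApproxLE.purify (hDP D D' hDD') hd hq hR hΘ h0 hdiam hε hδ hε' hω hω1
      (hrange D) (hrange D')
  · have hone := Purify.integral_lqNorm_one_purifyJoint_le hq hR.le hΘ h0 hdiam hδ hε'.le hω.le
      hω1 (hrange D)
    refine ⟨?_, fun hq' => ?_, hone⟩
    · rintro rfl
      simpa using hone
    · exact Purify.integral_lqNorm_self_purifyJoint_le hd hq hq' hR.le hΘ h0 hdiam hδ hε'.le
        hω.le hω1 (hrange D)

theorem theorem1 {𝒟 : Type*} (nbr : 𝒟 → 𝒟 → Prop) (hnbr : ∀ D D', nbr D D' → nbr D' D)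
    (d : ℕ) (hd : 1 ≤ d) (q : ℝ≥0∞) (hq : 1 ≤ q)
    (c : Fin d → ℝ) (R : ℝ) (hR : 0 < R)
    (Θ : Set (Fin d → ℝ)) (hΘ : Θ = Purify.lqBall q c (R / 2))
    (ε δ ε' ω : ℝ) (hε : 0 ≤ ε) (hδ : 0 ≤ δ) (hε' : 0 < ε') (hω : 0 < ω) (hω1 : ω ≤ 1)
    (M : 𝒟 → Measure (Fin d → ℝ)) (hM : ∀ D, IsProbabilityMeasure (M D))
    (hrange : ∀ D, ∀ᵐ x ∂(M D), x ∈ Θ)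
    (hDP : Purify.IsDP nbr M ε δ) :
    Purify.IsDP nbr (fun D => Purify.purify q R ε' δ ω Θ (M D)) (ε + ε') 0 ∧
    ∀ D,
      -- the utility guarantee in the `ℓ_1` norm, for a ball in the `ℓ_1` norm
      (q = 1 →
        Integrable (fun p => Purify.lqNorm 1 (p.2 - p.1))
          (Purify.purifyJoint q R ε' δ ω Θ (M D)) ∧
        ∫ p, Purify.lqNorm 1 (p.2 - p.1) ∂(Purify.purifyJoint q R ε' δ ω Θ (M D)) ≤
          ω * R + 4 * R * d / ε' * (δ / (2 * ω)) ^ (1 / (d : ℝ))) ∧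
      -- the utility guarantee in the `ℓ_q` norm, for a ball in the `ℓ_q` norm
      (q ≠ ∞ →
        Integrable (fun p => Purify.lqNorm q (p.2 - p.1))
          (Purify.purifyJoint q R ε' δ ω Θ (M D)) ∧
        ∫ p, Purify.lqNorm q (p.2 - p.1) ∂(Purify.purifyJoint q R ε' δ ω Θ (M D)) ≤
          ω * R + 4 * R * d * q.toReal / ε' * (δ / (2 * ω)) ^ (1 / (d : ℝ))) ∧
      -- the utility guarantee in the `ℓ_1` norm, for a ball in the `ℓ_q` norm
      (Integrable (fun p => Purify.lqNorm 1 (p.2 - p.1))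
          (Purify.purifyJoint q R ε' δ ω Θ (M D)) ∧
        ∫ p, Purify.lqNorm 1 (p.2 - p.1) ∂(Purify.purifyJoint q R ε' δ ω Θ (M D)) ≤
          (d : ℝ) ^ (1 - (q⁻¹).toReal) *
            (ω * R + 4 * R * d / ε' * (δ / (2 * ω)) ^ (1 / (d : ℝ)))) := by
  have : Fact (1 ≤ q) := ⟨hq⟩
  subst hΘ
  exact theorem1_general nbr d hd q hq R hR _ Purify.convex_lqBall
    (Purify.volume_lqBall_ne_zero (half_pos hR))
    (fun _ hx _ hy =>
      (Purify.lqNorm_sub_le_of_mem_lqBall hx hy).trans_eq (mul_div_cancel₀ R two_ne_zero))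
    ε δ ε' ω hε hδ hε' hω hω1 M hM hrange hDP
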